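/- Let $R$ be a ring and let $T$ be a complete first-order theory of (left) $R$-modules, that is, a complete theory in the language $\{0,-,+\}\cup\{r\cdot : r\in R\}$ all of whose models are $R$-modules. Let $\mathbf{K}$ be the class of models of $T$, ordered by the elementary substructure relation $\preccurlyeq$. Then $(\mathbf{K},\preccurlyeq)$ is stable in the sense of first-order logic, that is: 1. there are unboundedly many cardinals $\mu$ such that, for every $M\models T$, every $A\subseteq M$ with $|A|\le\mu$, and every $n<\omega$, there are at most $\mu$ complete $n$-types over $A$ (with respect to the theory of $M$ with names for the elements of $A$). Moreover, $(\mathbf{K},\preccurlyeq)$ is stable as an abstract elementary class, that is: 2. there are unboundedly many cardinals $\mu$ such that, for every $M\in\mathbf{K}$ with $|M|=\mu$, there are at most $\mu$ orbital (Galois) types over $M$. Here an orbital type over $M$ is an equivalence class of triples $(b,M,N)$, where $M\preccurlyeq N\in\mathbf{K}$ and $b\in N$, under the transitive closure of the following relation: $(b_1,M,N_1)$ is related to $(b_2,M,N_2)$ if there are $N\in\mathbf{K}$ and elementary embeddings $f_\ell:N_\ell\to N$ fixing $M$ pointwise ($\ell=1,2$) such that $f_1(b_1)=f_2(b_2)$.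 -/

import Mathlib

open FirstOrder Cardinal

universe u w

set_option linter.checkUnivs false

namespace ModuleStability

/-- Function symbols of the language of left `R`-modules: `0`, `-`, `+`, and, for each `r : R`,
a unary symbol for multiplication by `r`. -/
inductive ModuleFunc (R : Type u) : ℕ → Type u
  | zero : ModuleFunc R 0
  | neg : ModuleFunc R 1
  | add : ModuleFunc R 2
  | smul (r : R) : ModuleFunc R 1

/-- The first-order language of left `R`-modules (it has no relation symbols besides equality). -/
def moduleLanguage (R : Type u) : FirstOrder.Language.{u, 0} where
  Functions := ModuleFunc R
  Relations := fun _ => Empty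

/-- The interpretation of the function symbols in an `R`-module. -/
def moduleFunMap (R : Type u) (M : Type*) [Ring R] [AddCommGroup M] [Module R M] :
    ∀ {n : ℕ}, ModuleFunc R n → (Fin n → M) → M
  | _, .zero, _ => 0
  | _, .neg, x => - x 0
  | _, .add, x => x 0 + x 1
  | _, .smul r, x => r • x 0

/-- An `R`-module as a first-order structure in the language of `R`-modules. -/
@[reducible]
def moduleStructure (R : Type u) (M : Type*) [Ring R] [AddCommGroup M] [Module R M] :
    (moduleLanguage R).Structure M where
  funMap := fun f x => moduleFunMap R M f x
  RelMap := fun r _ => r.elim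

/-- A structure in the language of `R`-modules is an `R`-module if its interpretation of the
symbols comes from an actual `R`-module structure on its underlying set. -/
def IsModuleStructure (R : Type u) [Ring R] (M : Type*) [S : (moduleLanguage R).Structure M] :
    Prop :=
  ∃ (_ : AddCommGroup M) (_ : Module R M), S = moduleStructure R M

/-- `T` is a theory of `R`-modules: all its models are `R`-modules. -/
def IsTheoryOfModules (R : Type u) [Ring R] (T : (moduleLanguage R).Theory) : Prop :=
  ∀ M : T.ModelType.{u, 0, max u w}, IsModuleStructure R M

section Stability

variable {L : FirstOrder.Language.{u, 0}} (T : L.Theory)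

/-- First-order stability in the cardinal `μ`: for every model `M` of `T` and every parameter set
`A ⊆ M` with `|A| ≤ μ`, there are, for each `n`, at most `μ` complete `n`-types over `A`
(that is, complete `n`-types of the theory of `M` with names for the elements of `A`). -/
def FirstOrderStableIn (μ : Cardinal.{max u w}) : Prop :=
  ∀ (M : T.ModelType.{u, 0, max u w}) (A : Set M), #A ≤ μ →
    ∀ n : ℕ, #((L[[A]].completeTheory M).CompleteType (Fin n)) ≤ μ

/-- `T` is stable in the sense of first-order logic: it is stable in unboundedly many cardinals. -/
def FirstOrderStable : Prop :=
  ∀ κ : Cardinal.{max u w}, ∃ μ : Cardinal.{max u w}, κ ≤ μ ∧ FirstOrderStableIn.{u, w} T μ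

variable {T}

/-- The data `(b, M, N)` with `M ≼ N ⊨ T` and `b ∈ N`. The elementary extension `N` of `M` is given
through an elementary embedding of `M` into `N`. -/
structure PointedExtension (M : T.ModelType.{u, 0, max u w}) where
  /-- The elementary extension of `M`. -/
  N : T.ModelType.{u, 0, max u w}
  /-- The elementary embedding of `M` into `N`. -/
  incl : M ↪ₑ[L] N
  /-- The element whose type over `M` is considered. -/
  b : N

/-- The atomic equivalence of `(b₁, M, N₁)` and `(b₂, M, N₂)`: there are a model `N` of `T` and
elementary embeddings of `N₁` and `N₂` into `N` that agree on `M` and send `b₁` and `b₂` to the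
same element. -/
def AtomicEquiv {M : T.ModelType.{u, 0, max u w}} (p q : PointedExtension.{u, w} M) : Prop :=
  ∃ (N : T.ModelType.{u, 0, max u w}) (f : p.N ↪ₑ[L] N) (g : q.N ↪ₑ[L] N),
    (∀ m : M, f (p.incl m) = g (q.incl m)) ∧ f p.b = g q.b

/-- The set of orbital (Galois) types over `M` in the class of models of `T` ordered by `≼`: the
quotient of the set of all `(b, M, N)` by the equivalence relation which atomic equivalence
generates. Atomic equivalence is reflexive and symmetric, so this is its transitive closure. -/
def OrbitalType (M : T.ModelType.{u, 0, max u w}) : Type (max (u + 1) (w + 1)) :=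
  Quot (AtomicEquiv.{u, w} (M := M))

variable (T)

/-- The class of models of `T` ordered by `≼` is `μ`-stable: there are at most `μ` orbital types
over each model of cardinality `μ`. -/
def OrbitallyStableIn (μ : Cardinal.{max u w}) : Prop :=
  ∀ M : T.ModelType.{u, 0, max u w}, #M = μ →
    #(OrbitalType.{u, w} M) ≤ Cardinal.lift.{max (u + 1) (w + 1)} μ

/-- The class of models of `T` ordered by `≼` is stable as an abstract elementary class: it is
`μ`-stable for unboundedly many cardinals `μ`. -/
def OrbitallyStable : Prop :=
  ∀ κ : Cardinal.{max u w}, ∃ μ : Cardinal.{max u w}, κ ≤ μ ∧ OrbitallyStableIn.{u, w} T μ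

end Stability

end ModuleStability

/-!
Modules are stable because types over a set of parameters are governed by cosets of few subgroups.

Call a formula of the language of `R`-modules *subgroup-defining* if it defines a subgroup of the
group of tuples in every `R`-module (`DefinesSubgroup`). Equations are subgroup-defining, and the
property is preserved by conjunctions and existential quantifiers; no syntactic notion of positive
primitive formula is needed. The heart of the argument is the Baur–Monk theorem
(`exists_definesSubgroup_determining`): whether a tuple satisfies a given formula is determined,
within a class of elementarily equivalent modules, by its satisfying or not each of finitely many
subgroup-defining formulas. It is proved by induction on the formula. The step for a quantifier is a
one-step back-and-forth property (`exists_realize_snoc_iff`), which asks whether a coset is covered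
by finitely many other cosets. That is decided by which of these cosets have a common element, a
matter of subgroup-defining formulas, and by the indices of intersections of the subgroups in each
other, a matter of the theory of the module (`iUnion_eq_univ_of_iUnion_eq_univ`, from
B. H. Neumann's lemma and inclusion–exclusion).

An instance `φ(a,x)` of a subgroup-defining formula is empty or a coset, and two instances of the
same formula are equal or disjoint. So the type of a tuple over a set `A` is determined by choosing,
for each `φ`, some `a` in `A` such that `φ(a,x)` holds, if there is one (`code`,
`realize_iff_of_code_eq`). There are at most `μ` such choices if `#A ≤ μ` and
`μ ^ (ℵ₀ + |L|) = μ`, where `L` is the language (`mk_code_le`), and such `μ` are unbounded. This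
bounds the number of complete types. Orbital types are bounded in the same way, because elements
with the same type over `M` have the same orbital type by elementary amalgamation
(`exists_elementary_amalgam`).
-/

namespace ModuleStability

/-! ### Covering an abelian group by cosets -/

section Cosets

open scoped Pointwise

/-- If every finite set that embeds into `Y` embeds into the finite set `X`, then so does `Y`. -/
theorem finite_and_card_le_of_forall_nonempty_embedding {X Y : Type*} [Finite X]
    (h : ∀ k : ℕ, Nonempty (Fin k ↪ Y) → Nonempty (Fin k ↪ X)) :
    Finite Y ∧ Nat.card Y ≤ Nat.card X := by
  have hno : ¬ Nonempty (Fin (Nat.card X + 1) ↪ Y) := by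
    intro hY
    obtain ⟨e⟩ := h _ hY
    have := Nat.card_le_card_of_injective e e.injective
    simp at this
  have hY : Finite Y := by
    by_contra hinf
    rw [not_finite_iff_infinite] at hinf
    exact hno ⟨Fin.valEmbedding.trans (Infinite.natEmbedding Y)⟩
  refine ⟨hY, ?_⟩
  by_contra! hlt
  exact hno ⟨(Fin.castLEEmb hlt).trans (Finite.equivFin Y).symm.toEmbedding⟩

theorem card_eq_of_forall_nonempty_embedding {X Y : Type*}
    (h : ∀ k : ℕ, Nonempty (Fin k ↪ X) ↔ Nonempty (Fin k ↪ Y)) : Nat.card X = Nat.card Y := by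
  by_cases hX : Finite X
  · obtain ⟨hY, hYX⟩ := finite_and_card_le_of_forall_nonempty_embedding fun k => (h k).2
    exact le_antisymm
      (finite_and_card_le_of_forall_nonempty_embedding fun k => (h k).1).2 hYX
  · by_cases hY : Finite Y
    · exact absurd
        (finite_and_card_le_of_forall_nonempty_embedding fun k => (h k).1).1 hX
    · rw [not_finite_iff_infinite] at hX hY
      simp

/-- `H` contains `k` elements that are pairwise incongruent modulo `K`. -/
def HasIncongruent {G : Type*} [AddCommGroup G] (K H : AddSubgroup G) (k : ℕ) : Prop :=
  ∃ y : Fin k → G, (∀ i, y i ∈ H) ∧ ∀ i j, i ≠ j → y i - y j ∉ K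

theorem hasIncongruent_iff {G : Type*} [AddCommGroup G] (K H : AddSubgroup G) (k : ℕ) :
    HasIncongruent K H k ↔ Nonempty (Fin k ↪ H.map (QuotientAddGroup.mk' K)) := by
  constructor
  · rintro ⟨y, hy, hne⟩
    refine ⟨⟨fun i => ⟨QuotientAddGroup.mk' K (y i), AddSubgroup.mem_map_of_mem _ (hy i)⟩, ?_⟩⟩
    intro i j hij
    by_contra h
    refine hne j i (Ne.symm h) ?_
    have := QuotientAddGroup.eq.1 (Subtype.ext_iff.1 hij)
    rwa [neg_add_eq_sub] at this
  · rintro ⟨e⟩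
    choose y hy hye using fun i => AddSubgroup.mem_map.1 (e i).2
    refine ⟨y, hy, fun i j hij hmem => hij (e.injective (Subtype.ext ?_))⟩
    rw [← hye, ← hye]
    refine (QuotientAddGroup.eq.2 ?_).symm
    rwa [neg_add_eq_sub]

/-- Equality of the relative indices, where the value `0` of `relIndex` stands for an infinite
index. -/
theorem relIndex_eq_of_hasIncongruent_iff {G G' : Type*} [AddCommGroup G] [AddCommGroup G']
    {K H : AddSubgroup G} {K' H' : AddSubgroup G'}
    (h : ∀ k, HasIncongruent K H k ↔ HasIncongruent K' H' k) :
    K.relIndex H = K'.relIndex H' := by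
  have key := card_eq_of_forall_nonempty_embedding fun k =>
    ((hasIncongruent_iff K H k).symm.trans (h k)).trans (hasIncongruent_iff K' H' k)
  rwa [← AddSubgroup.relIndex_ker, ← AddSubgroup.relIndex_ker, QuotientAddGroup.ker_mk',
    QuotientAddGroup.ker_mk'] at key

/-- `X` is empty or a coset of `H`. -/
def IsCosetOrEmpty {G : Type*} [AddCommGroup G] (H : AddSubgroup G) (X : Set G) : Prop :=
  ∀ x ∈ X, ∀ y, y ∈ X ↔ y - x ∈ H

theorem IsCosetOrEmpty.eq_vadd {G : Type*} [AddCommGroup G] {H : AddSubgroup G} {X : Set G}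
    (hX : IsCosetOrEmpty H X) {x : G} (hx : x ∈ X) : X = x +ᵥ (H : Set G) := by
  ext y
  rw [hX x hx, mem_leftAddCoset_iff, neg_add_eq_sub, SetLike.mem_coe]

theorem IsCosetOrEmpty.biInter {G ι : Type*} [AddCommGroup G] {H : ι → AddSubgroup G}
    {X : ι → Set G} (hX : ∀ i, IsCosetOrEmpty (H i) (X i)) (t : Finset ι) :
    IsCosetOrEmpty (⨅ i ∈ t, H i) (⋂ i ∈ t, X i) := by
  intro x hx y
  simp only [Set.mem_iInter, AddSubgroup.mem_iInf] at hx ⊢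
  exact forall₂_congr fun i hi => hX i x (hx i hi) y

theorem IsCosetOrEmpty.ncard_image_mk {G : Type*} [AddCommGroup G] {H K : AddSubgroup G}
    {X : Set G} (hX : IsCosetOrEmpty H X) (hne : X.Nonempty) :
    (QuotientAddGroup.mk' K '' X).ncard = K.relIndex H := by
  obtain ⟨x, hx⟩ := hne
  have : QuotientAddGroup.mk' K '' X =
      (QuotientAddGroup.mk' K x + ·) '' (H.map (QuotientAddGroup.mk' K) : Set (G ⧸ K)) := by
    rw [hX.eq_vadd hx, AddSubgroup.coe_map, Set.image_image]
    ext q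
    simp only [Set.mem_image, mem_leftAddCoset_iff]
    constructor
    · rintro ⟨y, hy, rfl⟩
      exact ⟨-x + y, hy, by rw [← map_add, add_neg_cancel_left]⟩
    · rintro ⟨h, hh, rfl⟩
      exact ⟨x + h, by simpa using hh, map_add _ _ _⟩
  rw [this, Set.ncard_image_of_injective _ (add_right_injective _)]
  conv_rhs => rw [← QuotientAddGroup.ker_mk' K, AddSubgroup.relIndex_ker]
  rfl

open Classical in
/-- Inclusion–exclusion for finitely many cosets of subgroups of finite index: counting modulo the
intersection of the subgroups, whether they cover the group is decided by the relative indices of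
the intersections and by which cosets have a common element. -/
theorem biUnion_eq_univ_iff_sum_eq_zero {G ι : Type*} [AddCommGroup G] (J : Finset ι)
    {H : ι → AddSubgroup G} {X : ι → Set G} (hX : ∀ i, IsCosetOrEmpty (H i) (X i))
    (hfin : ∀ i ∈ J, (H i).FiniteIndex) :
    ⋃ i ∈ J, X i = Set.univ ↔
      ∑ t ∈ J.powerset, (-1 : ℤ) ^ t.card * (if (⋂ i ∈ t, X i).Nonempty then
        ((⨅ i ∈ J, H i).relIndex (⨅ i ∈ t, H i) : ℤ) else 0) = 0 := by
  set K := ⨅ i ∈ J, H i with hK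
  -- The sets `X i` are unions of classes modulo `K`; their images in `G ⧸ K` are counted.
  have hKfin : K.FiniteIndex := AddSubgroup.finiteIndex_iInf' H hfin
  have : Fintype (G ⧸ K) := Fintype.ofFinite _
  let A : ι → Finset (G ⧸ K) := fun i => (QuotientAddGroup.mk' K '' X i).toFinset
  have hA : ∀ i ∈ J, ∀ x : G, (x : G ⧸ K) ∈ A i ↔ x ∈ X i := by
    intro i hi x
    simp only [A, Set.mem_toFinset]
    refine ⟨?_, fun h => ⟨x, h, rfl⟩⟩
    rintro ⟨y, hy, hyx⟩
    rw [hX i y hy, ← neg_add_eq_sub]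
    have h1 : -y + x ∈ K := QuotientAddGroup.eq.1 hyx
    simp only [hK, AddSubgroup.mem_iInf] at h1
    exact h1 i hi
  have hcard : ∀ t ∈ J.powerset, ((t.inf A).card : ℤ) =
      if (⋂ i ∈ t, X i).Nonempty then (K.relIndex (⨅ i ∈ t, H i) : ℤ) else 0 := by
    intro t ht
    rw [Finset.mem_powerset] at ht
    have himg : ((t.inf A : Finset (G ⧸ K)) : Set (G ⧸ K)) =
        QuotientAddGroup.mk' K '' (⋂ i ∈ t, X i) := by
      ext q
      obtain ⟨x, rfl⟩ := QuotientAddGroup.mk_surjective q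
      simp only [Finset.mem_coe, Finset.mem_inf, Set.mem_image, Set.mem_iInter]
      constructor
      · exact fun h => ⟨x, fun i hi => (hA i (ht hi) x).1 (h i hi), rfl⟩
      · rintro ⟨y, hy, hyx⟩ i hi
        rw [← hyx]
        exact (hA i (ht hi) y).2 (hy i hi)
    rw [← Set.ncard_coe_finset, himg]
    split_ifs with hne
    · rw [(IsCosetOrEmpty.biInter hX t).ncard_image_mk hne]
    · rw [Set.not_nonempty_iff_eq_empty.1 hne]
      simp
  have hsum := Finset.sum_congr (rfl : J.powerset = J.powerset) fun t ht =>
    congrArg ((-1 : ℤ) ^ t.card * ·) (hcard t ht)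
  rw [← hsum, ← Finset.inclusion_exclusion_card_inf_compl, Nat.cast_eq_zero, Finset.card_eq_zero,
    Finset.eq_empty_iff_forall_notMem, Set.eq_univ_iff_forall]
  simp only [Finset.mem_inf, Finset.mem_compl, Set.mem_iUnion, not_forall, not_not,
    exists_prop]
  constructor
  · intro h q
    obtain ⟨x, rfl⟩ := QuotientAddGroup.mk_surjective q
    obtain ⟨i, hi, hx⟩ := h x
    exact ⟨i, hi, (hA i hi x).2 hx⟩
  · intro h x
    obtain ⟨i, hi, hx⟩ := h x
    exact ⟨i, hi, (hA i hi x).1 hx⟩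

/-- Whether finitely many cosets cover an abelian group is determined by the number of classes of
each intersection of the subgroups modulo each other one, and by which of the cosets have a common
element. By B. H. Neumann's lemma only the cosets of subgroups of finite index matter, and these
are counted by inclusion–exclusion. -/
theorem iUnion_eq_univ_of_iUnion_eq_univ {G G' ι : Type*} [AddCommGroup G] [AddCommGroup G']
    [Finite ι] {H : ι → AddSubgroup G} {X : ι → Set G} {H' : ι → AddSubgroup G'}
    {X' : ι → Set G'} (hX : ∀ i, IsCosetOrEmpty (H i) (X i))
    (hX' : ∀ i, IsCosetOrEmpty (H' i) (X' i))
    (hne : ∀ t : Finset ι, (⋂ i ∈ t, X i).Nonempty ↔ (⋂ i ∈ t, X' i).Nonempty)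
    (hidx : ∀ s t : Finset ι, ∀ k, HasIncongruent (⨅ i ∈ s, H i) (⨅ i ∈ t, H i) k ↔
      HasIncongruent (⨅ i ∈ s, H' i) (⨅ i ∈ t, H' i) k)
    (hcov : ⋃ i, X i = Set.univ) : ⋃ i, X' i = Set.univ := by
  classical
  have := Fintype.ofFinite ι
  have hrel : ∀ s t : Finset ι, (⨅ i ∈ s, H i).relIndex (⨅ i ∈ t, H i) =
      (⨅ i ∈ s, H' i).relIndex (⨅ i ∈ t, H' i) :=
    fun s t => relIndex_eq_of_hasIncongruent_iff (hidx s t)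
  have hind : ∀ i, (H i).index = (H' i).index := fun i => by
    simpa using hrel {i} ∅
  -- The index of `H i` is its relative index in the empty intersection, so `J` is also the set of
  -- indices for which `H' i` has finite index.
  let J : Finset ι := {i | (H i).FiniteIndex}
  have hJ : ∀ i ∈ J, (H i).FiniteIndex := fun i hi => by simpa [J] using hi
  have hJ' : ∀ i ∈ J, (H' i).FiniteIndex := fun i hi =>
    ⟨by rw [← hind]; exact (hJ i hi).index_ne_zero⟩
  have hcovJ : ⋃ i ∈ J, X i = Set.univ := by
    -- Neumann's lemma is about cosets, so the indices of empty sets are left out.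
    let g : ι → G := fun i => if h : (X i).Nonempty then h.some else 0
    have hg : ∀ i, (X i).Nonempty → X i = g i +ᵥ (H i : Set G) := fun i h => by
      have : g i = h.some := dif_pos h
      rw [this]
      exact (hX i).eq_vadd h.some_mem
    have h1 : ⋃ i ∈ ({i | (X i).Nonempty} : Finset ι), g i +ᵥ (H i : Set G) = Set.univ := by
      rw [Set.eq_univ_iff_forall] at hcov ⊢
      intro x
      obtain ⟨i, hi⟩ := Set.mem_iUnion.1 (hcov x)
      refine Set.mem_iUnion₂.2 ⟨i, by simpa using ⟨x, hi⟩, ?_⟩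
      rwa [← hg i ⟨x, hi⟩]
    have h2 := AddSubgroup.leftCoset_cover_filter_FiniteIndex h1
    rw [Set.eq_univ_iff_forall] at h2 ⊢
    intro x
    obtain ⟨i, hi, hx⟩ := Set.mem_iUnion₂.1 (h2 x)
    simp only [Finset.mem_filter, Finset.mem_univ, true_and] at hi
    exact Set.mem_iUnion₂.2 ⟨i, by simpa [J] using hi.2, by rwa [hg i hi.1]⟩
  rw [biUnion_eq_univ_iff_sum_eq_zero J hX hJ] at hcovJ
  have hcovJ' : ⋃ i ∈ J, X' i = Set.univ := by
    rw [biUnion_eq_univ_iff_sum_eq_zero J hX' hJ']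
    refine Eq.trans (Finset.sum_congr rfl fun t _ => ?_) hcovJ
    rw [hrel]
    simp only [hne t]
  rw [Set.eq_univ_iff_forall] at hcovJ' ⊢
  intro x
  obtain ⟨i, -, hx⟩ := Set.mem_iUnion₂.1 (hcovJ' x)
  exact Set.mem_iUnion.2 ⟨i, hx⟩

end Cosets

/-! ### Subgroup-defining formulas and the Baur–Monk theorem -/

section Elimination

open Language

universe v u' u''

attribute [local instance] moduleStructure

variable {R : Type u} [Ring R] {α : Type u'} {β : Type u''} {n : ℕ}

section Terms

variable {M : Type v} [AddCommGroup M] [Module R M]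

theorem realize_term_zero (t : (moduleLanguage R).Term α) : t.realize (0 : α → M) = 0 := by
  induction t with
  | var => rfl
  | func f ts ih =>
    rw [Term.realize_func]
    simp only [ih]
    cases f with
    | zero => rfl
    | neg => exact neg_zero
    | add => exact add_zero 0
    | smul r => exact smul_zero r

theorem realize_term_sub (t : (moduleLanguage R).Term α) (v w : α → M) :
    t.realize (v - w) = t.realize v - t.realize w := by
  induction t with
  | var => rfl
  | func f ts ih =>
    simp only [Term.realize_func, ih]
    cases f with
    | zero => exact (sub_zero 0).symm
    | neg => exact neg_sub' (_ : M) _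
    | add => exact (add_sub_add_comm (_ : M) _ _ _).symm
    | smul r => exact smul_sub r _ _

/-- The term `0`. -/
def zeroTerm : (moduleLanguage R).Term α :=
  Term.func (L := moduleLanguage R) ModuleFunc.zero ![]

/-- The term `s - t`, written as `s + (-t)`. -/
def subTerm (s t : (moduleLanguage R).Term α) : (moduleLanguage R).Term α :=
  Functions.apply₂ (L := moduleLanguage R) ModuleFunc.add s
    (Functions.apply₁ (L := moduleLanguage R) ModuleFunc.neg t)

theorem realize_zeroTerm (v : α → M) :
    (zeroTerm : (moduleLanguage R).Term α).realize v = 0 := rfl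

theorem realize_subTerm (s t : (moduleLanguage R).Term α) (v : α → M) :
    (subTerm s t).realize v = s.realize v - t.realize v :=
  (sub_eq_add_neg _ _).symm

end Terms

theorem sumElim_sub {M : Type*} [AddCommGroup M] {γ δ : Type*} (v w : γ → M) (xs ys : δ → M) :
    Sum.elim (v - w) (xs - ys) = Sum.elim v xs - Sum.elim w ys := by
  ext (_ | _) <;> rfl

theorem snoc_sub {M : Type*} [AddCommGroup M] (xs ys : Fin n → M) (a b : M) :
    (Fin.snoc (xs - ys) (a - b) : Fin (n + 1) → M) = Fin.snoc xs a - Fin.snoc ys b := by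
  ext i
  refine Fin.lastCases ?_ (fun j => ?_) i <;> simp

theorem snoc_zero {M : Type*} [AddCommGroup M] :
    (Fin.snoc (0 : Fin n → M) (0 : M) : Fin (n + 1) → M) = 0 := by
  ext i
  refine Fin.lastCases ?_ (fun j => ?_) i <;> simp

/-- The formula `φ` defines a subgroup of the group of all tuples in every `R`-module. All positive
primitive formulas have this property, which is all that is needed of them. -/
def DefinesSubgroup (φ : (moduleLanguage R).BoundedFormula α n) : Prop :=
  ∀ (M : Type v) [AddCommGroup M] [Module R M],
    φ.Realize (0 : α → M) 0 ∧ ∀ (v w : α → M) (xs ys : Fin n → M),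
      φ.Realize v xs → φ.Realize w ys → φ.Realize (v - w) (xs - ys)

theorem definesSubgroup_equal (s t : (moduleLanguage R).Term (α ⊕ Fin n)) :
    DefinesSubgroup.{u, v} (BoundedFormula.equal s t) := by
  intro M _ _
  have h0 : Sum.elim (0 : α → M) (0 : Fin n → M) = 0 := by ext (_ | _) <;> rfl
  simp only [BoundedFormula.Realize, h0, sumElim_sub, realize_term_zero, realize_term_sub,
    true_and]
  intro v w xs ys h h'
  rw [h, h']

theorem DefinesSubgroup.iInf {ι : Type*} [Finite ι]
    {f : ι → (moduleLanguage R).BoundedFormula α n} (hf : ∀ i, DefinesSubgroup.{u, v} (f i)) :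
    DefinesSubgroup.{u, v} (BoundedFormula.iInf f) := by
  intro M _ _
  simp only [BoundedFormula.realize_iInf]
  exact ⟨fun i => (hf i M).1, fun v w xs ys h h' i => (hf i M).2 v w xs ys (h i) (h' i)⟩

theorem DefinesSubgroup.ex {φ : (moduleLanguage R).BoundedFormula α (n + 1)}
    (hφ : DefinesSubgroup.{u, v} φ) : DefinesSubgroup.{u, v} φ.ex := by
  intro M _ _
  simp only [BoundedFormula.realize_ex]
  refine ⟨⟨0, ?_⟩, ?_⟩
  · rw [snoc_zero]
    exact (hφ M).1
  · rintro v w xs ys ⟨a, ha⟩ ⟨b, hb⟩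
    refine ⟨a - b, ?_⟩
    rw [snoc_sub]
    exact (hφ M).2 _ _ _ _ ha hb

theorem DefinesSubgroup.realize_iff_realize_sub {φ : (moduleLanguage R).BoundedFormula α n}
    (hφ : DefinesSubgroup.{u, v} φ) {M : Type v} [AddCommGroup M] [Module R M]
    {v w : α → M} {xs ys : Fin n → M} (h : φ.Realize v xs) :
    φ.Realize w ys ↔ φ.Realize (w - v) (ys - xs) := by
  refine ⟨fun h' => (hφ M).2 _ _ _ _ h' h, fun h' => ?_⟩
  have h1 := (hφ M).2 _ _ _ _ (hφ M).1 h
  have h2 := (hφ M).2 _ _ _ _ h' h1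
  simpa using h2

/-- The subgroup that `φ` defines in the last variable when the others are set to `0`. -/
def DefinesSubgroup.fiber {φ : (moduleLanguage R).BoundedFormula α (n + 1)}
    (hφ : DefinesSubgroup.{u, v} φ) (M : Type v) [AddCommGroup M] [Module R M] :
    AddSubgroup M :=
  AddSubgroup.ofSub {h | φ.Realize (0 : α → M) (Fin.snoc (0 : Fin n → M) h)}
    ⟨0, by
      rw [Set.mem_ofPred_eq, snoc_zero]
      exact (hφ M).1⟩
    (fun x hx y hy => by
      have := (hφ M).2 _ _ _ _ hx hy
      rwa [← snoc_sub, sub_zero, sub_zero, sub_eq_add_neg] at this)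

theorem DefinesSubgroup.mem_fiber {φ : (moduleLanguage R).BoundedFormula α (n + 1)}
    (hφ : DefinesSubgroup.{u, v} φ) {M : Type v} [AddCommGroup M] [Module R M] {h : M} :
    h ∈ hφ.fiber M ↔ φ.Realize (0 : α → M) (Fin.snoc (0 : Fin n → M) h) := Iff.rfl

theorem DefinesSubgroup.realize_snoc_iff {φ : (moduleLanguage R).BoundedFormula α (n + 1)}
    (hφ : DefinesSubgroup.{u, v} φ) {M : Type v} [AddCommGroup M] [Module R M]
    {v : α → M} {xs : Fin n → M} {a b : M} (h : φ.Realize v (Fin.snoc xs a)) :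
    φ.Realize v (Fin.snoc xs b) ↔ b - a ∈ hφ.fiber M := by
  rw [hφ.realize_iff_realize_sub h, ← snoc_sub, sub_self, sub_self, hφ.mem_fiber]

/-- The formula `φ` with the term `t` for its last variable and `0` for the others. -/
def substLast (φ : (moduleLanguage R).BoundedFormula α (n + 1)) (t : (moduleLanguage R).Term β) :
    (moduleLanguage R).Formula β :=
  φ.toFormula.subst (Sum.elim (fun _ => zeroTerm) (Fin.snoc (fun _ => zeroTerm) t))

theorem realize_substLast (φ : (moduleLanguage R).BoundedFormula α (n + 1))
    (t : (moduleLanguage R).Term β) {M : Type v} [AddCommGroup M] [Module R M] (v : β → M) :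
    (substLast φ t).Realize v ↔ φ.Realize (0 : α → M) (Fin.snoc (0 : Fin n → M) (t.realize v)) := by
  rw [substLast, Formula.Realize, BoundedFormula.realize_subst, ← Formula.Realize,
    BoundedFormula.realize_toFormula]
  have : ((fun a => Term.realize v (Sum.elim (fun _ : α => zeroTerm)
      (Fin.snoc (fun _ => zeroTerm) t : Fin (n + 1) → (moduleLanguage R).Term β) a)) ∘ Sum.inr) =
      (Fin.snoc (0 : Fin n → M) (t.realize v) : Fin (n + 1) → M) := by
    ext i
    refine Fin.lastCases ?_ (fun j => ?_) i
    · simp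
    · simp [realize_zeroTerm]
  rw [this]
  rfl

/-- The number of classes of one definable subgroup modulo another is expressed by sentences. -/
theorem hasIncongruent_iff_of_elementarilyEquivalent {ι : Type*} [Finite ι]
    {f : ι → (moduleLanguage R).BoundedFormula α (n + 1)}
    (hf : ∀ i, DefinesSubgroup.{u, v} (f i)) {M N : Type v} [AddCommGroup M] [Module R M]
    [AddCommGroup N] [Module R N] (hMN : M ≅[moduleLanguage R] N) (s t : Set ι) (k : ℕ) :
    HasIncongruent (⨅ i ∈ s, (hf i).fiber M) (⨅ i ∈ t, (hf i).fiber M) k →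
      HasIncongruent (⨅ i ∈ s, (hf i).fiber N) (⨅ i ∈ t, (hf i).fiber N) k := by
  let ψ : (moduleLanguage R).Formula (Empty ⊕ Fin k) :=
    Formula.iInf (fun p : t × Fin k => substLast (f p.1) (Term.var (Sum.inr p.2))) ⊓
      Formula.iInf (fun p : {p : Fin k × Fin k // p.1 ≠ p.2} =>
        ∼(Formula.iInf fun i : s => substLast (f i)
          (subTerm (Term.var (Sum.inr p.1.1)) (Term.var (Sum.inr p.1.2)))))
  let σ : (moduleLanguage R).Sentence := Formula.iExs (Fin k) ψ
  have key : ∀ (P : Type v) [AddCommGroup P] [Module R P], P ⊨ σ ↔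
      HasIncongruent (⨅ i ∈ s, (hf i).fiber P) (⨅ i ∈ t, (hf i).fiber P) k := by
    intro P _ _
    simp only [σ, ψ, Sentence.Realize, Formula.realize_iExs, Formula.realize_inf,
      Formula.realize_iInf, Formula.realize_not, realize_substLast, realize_subTerm,
      Term.realize_var, Sum.elim_inr, HasIncongruent, AddSubgroup.mem_iInf,
      DefinesSubgroup.mem_fiber, Prod.forall, Subtype.forall]
    refine exists_congr fun y => and_congr ?_ ?_
    · exact ⟨fun h j i hi => h i hi j, fun h i hi j => h j i hi⟩
    · exact Iff.rfl
  rw [← key, ← key]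
  exact (elementarilyEquivalent_iff.1 hMN σ).1


section Step

variable {ι : Type} {f : ι → (moduleLanguage R).BoundedFormula α (n + 1)}
  {M : Type v} [AddCommGroup M] [Module R M]

/-- The subgroup that the conjunction of the `f i` for `i ∈ P` defines in the last variable when the
others are set to `0`. -/
abbrev fiberInf (hf : ∀ i, DefinesSubgroup.{u, v} (f i)) (P : Set ι) :
    AddSubgroup M :=
  ⨅ i ∈ P, (hf i).fiber M

theorem realize_snoc_add (hf : ∀ i, DefinesSubgroup.{u, v} (f i))
    {P : Set ι} {v : α → M} {xs : Fin n → M} {c : M}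
    (hc : ∀ i ∈ P, (f i).Realize v (Fin.snoc xs c)) (h : M) :
    (∀ i ∈ P, (f i).Realize v (Fin.snoc xs (c + h))) ↔ h ∈ fiberInf (M := M) hf P := by
  simp only [AddSubgroup.mem_iInf]
  refine forall₂_congr fun i hi => ?_
  rw [(hf i).realize_snoc_iff (hc i hi), add_sub_cancel_left]

/-- Translated by `-c`, where `c` is a common solution of the `f i` with `i ∈ P`, the solutions of a
further `f i` in the coset `c + fiberInf hf P` form a coset of a subgroup of `fiberInf hf P`, or the
empty set. -/
theorem isCosetOrEmpty_translate (hf : ∀ i, DefinesSubgroup.{u, v} (f i))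
    (P : Set ι) (v : α → M) (xs : Fin n → M) (c : M) (i : ι) :
    IsCosetOrEmpty (((hf i).fiber M).addSubgroupOf (fiberInf hf P))
      {h | (f i).Realize v (Fin.snoc xs (c + h))} := by
  intro x hx y
  rw [Set.mem_ofPred_eq, (hf i).realize_snoc_iff hx, AddSubgroup.mem_addSubgroupOf]
  simp

theorem nonempty_biInter_translate_iff (hf : ∀ i, DefinesSubgroup.{u, v} (f i))
    {P : Set ι} {v : α → M} {xs : Fin n → M} {c : M}
    (hc : ∀ i ∈ P, (f i).Realize v (Fin.snoc xs c)) (t : Finset {i // i ∉ P}) :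
    (⋂ i ∈ t, {h : fiberInf (M := M) hf P |
        (f i).Realize v (Fin.snoc xs (c + h))}).Nonempty ↔
      ∃ a, ∀ i ∈ P ∪ Subtype.val '' (t : Set {i // i ∉ P}), (f i).Realize v (Fin.snoc xs a) := by
  constructor
  · rintro ⟨h, hh⟩
    refine ⟨c + h, ?_⟩
    rintro i (hi | ⟨j, hj, rfl⟩)
    · exact (realize_snoc_add hf hc h).2 h.2 i hi
    · exact Set.mem_iInter₂.1 hh j hj
  · rintro ⟨a, ha⟩
    have hmem : a - c ∈ fiberInf (M := M) hf P := by
      rw [← realize_snoc_add hf hc]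
      intro i hi
      rw [add_sub_cancel]
      exact ha i (Or.inl hi)
    refine ⟨⟨a - c, hmem⟩, Set.mem_iInter₂.2 fun i hi => ?_⟩
    rw [Set.mem_ofPred_eq]
    dsimp only
    rw [add_sub_cancel]
    exact ha i (Or.inr ⟨i, hi, rfl⟩)

theorem hasIncongruent_addSubgroupOf_iff (hf : ∀ i, DefinesSubgroup.{u, v} (f i))
    (P : Set ι) (s t : Finset {i // i ∉ P}) (k : ℕ) :
    HasIncongruent (⨅ i ∈ s, ((hf i).fiber M).addSubgroupOf (fiberInf hf P))
        (⨅ i ∈ t, ((hf i).fiber M).addSubgroupOf (fiberInf hf P)) k ↔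
      HasIncongruent (fiberInf (M := M) hf (Subtype.val '' (s : Set {i // i ∉ P})))
        (fiberInf (M := M) hf (P ∪ Subtype.val '' (t : Set {i // i ∉ P}))) k := by
  have hs : ∀ y : fiberInf (M := M) hf P,
      y ∈ ⨅ i ∈ s, ((hf i).fiber M).addSubgroupOf (fiberInf hf P) ↔
        (y : M) ∈ fiberInf (M := M) hf (Subtype.val '' (s : Set {i // i ∉ P})) := by
    intro y
    simp [AddSubgroup.mem_iInf, AddSubgroup.mem_addSubgroupOf]
  have ht : ∀ y : M, y ∈ fiberInf (M := M) hf (P ∪ Subtype.val '' (t : Set {i // i ∉ P})) ↔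
      ∃ h : y ∈ fiberInf (M := M) hf P,
        (⟨y, h⟩ : fiberInf (M := M) hf P) ∈
          ⨅ i ∈ t, ((hf i).fiber M).addSubgroupOf (fiberInf hf P) := by
    intro y
    simp only [fiberInf, AddSubgroup.mem_iInf, AddSubgroup.mem_addSubgroupOf, exists_prop,
      Set.mem_union, or_imp, forall_and, Set.mem_image, Finset.mem_coe, Subtype.exists,
      exists_and_right, exists_eq_right, forall_exists_index, Subtype.forall]
  constructor
  · rintro ⟨y, hy, hne⟩
    exact ⟨fun i => y i, fun i => (ht _).2 ⟨(y i).2, hy i⟩,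
      fun i j hij => fun h => hne i j hij ((hs _).2 h)⟩
  · rintro ⟨y, hy, hne⟩
    choose h1 h2 using fun i => (ht _).1 (hy i)
    exact ⟨fun i => ⟨y i, h1 i⟩, h2, fun i j hij h => hne i j hij ((hs _).1 h)⟩

/-- The back-and-forth step. Tuples of elementarily equivalent modules that satisfy the same
formulas `∃ y, ⋀ i ∈ S, f i` can be extended by one element each so that they satisfy the same
`f i`: otherwise the coset of one of the modules on which the right `f i` hold is covered by the
cosets on which one of the wrong ones holds, hence so is that of the other module. -/
theorem exists_realize_snoc_iff [Finite ι] (hf : ∀ i, DefinesSubgroup.{u, v} (f i))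
    {N : Type v} [AddCommGroup N] [Module R N]
    (hMN : M ≅[moduleLanguage R] N) {v : α → M} {xs : Fin n → M} {w : α → N} {ys : Fin n → N}
    (h : ∀ S : Set ι, (∃ a, ∀ i ∈ S, (f i).Realize v (Fin.snoc xs a)) ↔
      ∃ a, ∀ i ∈ S, (f i).Realize w (Fin.snoc ys a)) (c : M) :
    ∃ d : N, ∀ i, (f i).Realize v (Fin.snoc xs c) ↔ (f i).Realize w (Fin.snoc ys d) := by
  -- `P` consists of the formulas that `d` has to satisfy; the other ones it has to avoid.
  let P : Set ι := {i | (f i).Realize v (Fin.snoc xs c)}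
  have hc : ∀ i ∈ P, (f i).Realize v (Fin.snoc xs c) := fun i hi => hi
  obtain ⟨d, hd⟩ := (h P).1 ⟨c, hc⟩
  by_contra! hcon
  have hcov : ⋃ i : {i // i ∉ P}, {h : fiberInf (M := N) hf P |
      (f i).Realize w (Fin.snoc ys (d + h))} = Set.univ := by
    rw [Set.eq_univ_iff_forall]
    intro h
    have hP := (realize_snoc_add hf hd h).2 h.2
    obtain ⟨i, hi⟩ := hcon (d + h)
    have hiP : i ∉ P := fun hiP => by
      rcases hi with hi | hi
      · exact hi.2 (hP i hiP)
      · exact hi.1 hiP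
    rcases hi with hi | hi
    · exact absurd hi.1 hiP
    · exact Set.mem_iUnion.2 ⟨⟨i, hiP⟩, hi.2⟩
  have hcov' := iUnion_eq_univ_of_iUnion_eq_univ
    (fun i : {i // i ∉ P} => isCosetOrEmpty_translate hf P w ys d i)
    (fun i : {i // i ∉ P} => isCosetOrEmpty_translate hf P v xs c i)
    (fun t => by
      rw [nonempty_biInter_translate_iff hf hd, nonempty_biInter_translate_iff hf hc, h])
    (fun s t k => by
      rw [hasIncongruent_addSubgroupOf_iff, hasIncongruent_addSubgroupOf_iff]
      exact ⟨hasIncongruent_iff_of_elementarilyEquivalent hf hMN.symm _ _ k,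
        hasIncongruent_iff_of_elementarilyEquivalent hf hMN _ _ k⟩) hcov
  -- The element `0` of the translate corresponds to `c`, which lies in none of the wrong cosets.
  obtain ⟨i, hi⟩ := Set.mem_iUnion.1 (hcov'.symm ▸ Set.mem_univ (0 : fiberInf (M := M) hf P))
  have hi' : (f i).Realize v (Fin.snoc xs c) := by simpa using hi
  exact i.2 hi'

end Step

/-- **Baur–Monk theorem**, semantic form: for every formula there are finitely many formulas
defining subgroups whose truth values at a tuple of a module determine its truth value there, for
tuples of modules that are elementarily equivalent to each other. -/
theorem exists_definesSubgroup_determining (φ : (moduleLanguage R).BoundedFormula α n) :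
    ∃ (ι : Type) (_ : Finite ι) (f : ι → (moduleLanguage R).BoundedFormula α n),
      (∀ i, DefinesSubgroup.{u, v} (f i)) ∧
      ∀ (M N : Type v) [AddCommGroup M] [Module R M] [AddCommGroup N] [Module R N],
        (M ≅[moduleLanguage R] N) → ∀ (v : α → M) (xs : Fin n → M) (w : α → N) (ys : Fin n → N),
        (∀ i, (f i).Realize v xs ↔ (f i).Realize w ys) → (φ.Realize v xs ↔ φ.Realize w ys) := by
  induction φ with
  | falsum => exact ⟨Empty, inferInstance, Empty.elim, fun i => i.elim, fun _ _ => by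
      intros; exact Iff.rfl⟩
  | equal s t => exact ⟨Unit, inferInstance, fun _ => .equal s t,
      fun _ => definesSubgroup_equal s t, fun _ _ _ _ _ _ _ _ _ _ _ h => h ()⟩
  | rel r => exact r.elim
  | imp φ ψ ihφ ihψ =>
    obtain ⟨ι, _, f, hf, hφ⟩ := ihφ
    obtain ⟨κ, _, g, hg, hψ⟩ := ihψ
    refine ⟨ι ⊕ κ, inferInstance, Sum.elim f g, Sum.rec hf hg, ?_⟩
    intro M N _ _ _ _ hMN v xs w ys h
    rw [BoundedFormula.realize_imp, BoundedFormula.realize_imp,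
      hφ M N hMN v xs w ys fun i => h (Sum.inl i), hψ M N hMN v xs w ys fun i => h (Sum.inr i)]
  | all φ ih =>
    obtain ⟨ι, _, f, hf, hφ⟩ := ih
    refine ⟨Set ι, inferInstance, fun S => (BoundedFormula.iInf fun i : S => f i).ex,
      fun S => (DefinesSubgroup.iInf fun i : S => hf i).ex, ?_⟩
    intro M N _ _ _ _ hMN v xs w ys h
    simp only [BoundedFormula.realize_ex, BoundedFormula.realize_iInf, Subtype.forall] at h
    rw [BoundedFormula.realize_all, BoundedFormula.realize_all]
    constructor
    · intro hall d
      obtain ⟨c, hc⟩ := exists_realize_snoc_iff hf hMN.symm (fun S => (h S).symm) d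
      exact (hφ M N hMN _ _ _ _ fun i => (hc i).symm).1 (hall c)
    · intro hall c
      obtain ⟨d, hd⟩ := exists_realize_snoc_iff hf hMN h c
      exact (hφ M N hMN _ _ _ _ hd).2 (hall d)

end Elimination

/-! ### Types are determined by codes -/

section Codes

open Language

universe v u' u''

/-- A formula involves only finitely many of its parameters. -/
theorem exists_realize_iff_relabel {L : FirstOrder.Language} {A : Type u'} {B : Type u''}
    (φ : L.Formula (A ⊕ B)) :
    ∃ (m : ℕ) (ψ : L.Formula (Fin m ⊕ B)) (a : Fin m → A), ∀ (M : Type v) [L.Structure M]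
      (c : A → M) (v : B → M), φ.Realize (Sum.elim c v) ↔ ψ.Realize (Sum.elim (c ∘ a) v) := by
  classical
  let s := φ.freeVarFinset
  let t : Finset A := s.toLeft
  let f : s → Fin t.card ⊕ B := fun x => match x with
    | ⟨Sum.inl a, h⟩ => Sum.inl (t.equivFin ⟨a, Finset.mem_toLeft.2 h⟩)
    | ⟨Sum.inr b, _⟩ => Sum.inr b
  refine ⟨t.card, φ.restrictFreeVar f, fun i => t.equivFin.symm i, fun M _ c v => ?_⟩
  refine (BoundedFormula.realize_restrictFreeVar (Sum.elim c v) ?_).symm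
  rintro ⟨a | b, h⟩ <;> simp [f]

/-- A code is a choice, for each formula `φ(y₁,…,yₘ,x₁,…,xₙ)`, of either an `m`-tuple from `A` or
nothing. -/
def Code (L : FirstOrder.Language.{u, 0}) (A : Type v) (n : ℕ) : Type (max u v) :=
  ∀ i : Σ m : ℕ, L.Formula (Fin m ⊕ Fin n), Option (Fin i.1 → A)

open Classical in
/-- The code of an `n`-tuple `v` over the parameters `c`: it chooses for each formula `φ(y,x)` a
tuple `a` of parameters such that `φ(a,v)` holds, if there is one. -/
noncomputable def code {L : FirstOrder.Language.{u, 0}} {A : Type v} {n : ℕ} {N : Type*}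
    [L.Structure N] (c : A → N) (v : Fin n → N) : Code L A n :=
  fun i => if h : ∃ a : Fin i.1 → A, i.2.Realize (Sum.elim (c ∘ a) v) then some h.choose else none

/-- If two tuples have the same code and one of them satisfies some instance of `φ`, then they
satisfy a common one, namely the chosen one. -/
theorem exists_common_of_code_eq {L : FirstOrder.Language.{u, 0}} {A : Type v} {n : ℕ}
    {N N' : Type*} [L.Structure N] [L.Structure N'] {c : A → N} {v : Fin n → N} {c' : A → N'}
    {v' : Fin n → N'} (h : code (L := L) c v = code c' v') {m : ℕ}
    (φ : L.Formula (Fin m ⊕ Fin n)) {a : Fin m → A} (ha : φ.Realize (Sum.elim (c ∘ a) v)) :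
    ∃ a₀ : Fin m → A, φ.Realize (Sum.elim (c ∘ a₀) v) ∧ φ.Realize (Sum.elim (c' ∘ a₀) v') := by
  have hex : ∃ a : Fin m → A, φ.Realize (Sum.elim (c ∘ a) v) := ⟨a, ha⟩
  have h1 : code (L := L) c v ⟨m, φ⟩ = some hex.choose := dif_pos hex
  rw [h] at h1
  by_cases hex' : ∃ a : Fin m → A, φ.Realize (Sum.elim (c' ∘ a) v')
  · have h2 : code (L := L) c' v' ⟨m, φ⟩ = some hex'.choose := dif_pos hex'
    rw [h2, Option.some_inj] at h1
    exact ⟨hex.choose, hex.choose_spec, h1 ▸ hex'.choose_spec⟩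
  · have h2 : code (L := L) c' v' ⟨m, φ⟩ = none := dif_neg hex'
    rw [h2] at h1
    exact absurd h1 (by simp)

theorem mk_code_le {L : FirstOrder.Language.{u, 0}} {A : Type (max u w)} {n : ℕ}
    {μ : Cardinal.{max u w}} (hμ : ℵ₀ ≤ μ) (hpow : μ ^ lift.{w} (max ℵ₀ L.card) = μ)
    (hA : #A ≤ μ) : #(Code L A n) ≤ μ := by
  have hidx : #(Σ m : ℕ, L.Formula (Fin m ⊕ Fin n)) ≤ max ℵ₀ L.card := by
    rw [mk_sigma]
    refine (sum_le_sum _ (fun _ => max ℵ₀ L.card) fun m => ?_).trans ?_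
    · have h1 : #(L.Formula (Fin m ⊕ Fin n)) ≤
          #(Σ k, L.BoundedFormula (Fin m ⊕ Fin n) k) :=
        mk_le_of_injective (f := fun φ => ⟨0, φ⟩) fun φ ψ h => by simpa using h
      refine h1.trans (BoundedFormula.card_le.trans (max_le (le_max_left _ _) ?_))
      refine (add_le_max _ _).trans (max_le (max_le ?_ ?_) (le_max_left _ _))
      · exact le_max_of_le_left (lift_le_aleph0.2 mk_le_aleph0)
      · simp
    · simp
  have hpow' : μ ^ lift.{w} #(Σ m : ℕ, L.Formula (Fin m ⊕ Fin n)) ≤ μ :=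
    (power_le_power_left (aleph0_pos.trans_le hμ).ne' (lift_le.2 hidx)).trans hpow.le
  have hopt : ∀ m : ℕ, #(Option (Fin m → A)) ≤ μ := by
    intro m
    rw [mk_option]
    refine add_le_of_le hμ ?_ (one_le_aleph0.trans hμ)
    have : #(Fin m → A) = #A ^ (m : Cardinal) := by simp
    rw [this]
    exact (power_le_power_right hA).trans (power_nat_le hμ)
  have : #(Code L A n) = prod fun i : Σ m : ℕ, L.Formula (Fin m ⊕ Fin n) =>
      #(Option (Fin i.1 → A)) := mk_pi _
  rw [this]
  refine (prod_le_prod _ (fun _ => μ)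
    fun i : Σ m : ℕ, L.Formula (Fin m ⊕ Fin n) => hopt i.1).trans ?_
  rw [prod_const]
  rwa [lift_id'.{u, max u w}, lift_umax.{u, w}]

variable {R : Type u} [Ring R]

/-- Two instances of `φ` with a common solution `x` have the same solutions, since they define cosets
of the same subgroup. -/
theorem DefinesSubgroup.realize_exchange {γ : Type u'} {δ : Type u''}
    {φ : (moduleLanguage R).Formula (γ ⊕ δ)} (hφ : DefinesSubgroup.{u, v} φ) {M : Type v}
    [(moduleLanguage R).Structure M] (hM : IsModuleStructure R M) {a b : γ → M} {x y : δ → M}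
    (hax : φ.Realize (Sum.elim a x)) (hbx : φ.Realize (Sum.elim b x))
    (hby : φ.Realize (Sum.elim b y)) : φ.Realize (Sum.elim a y) := by
  obtain ⟨_, _, rfl⟩ := hM
  have h := (hφ.realize_iff_realize_sub hbx).1 hax
  rw [← sumElim_sub, sub_self, Subsingleton.elim (default - default) default] at h
  refine (hφ.realize_iff_realize_sub hby).2 ?_
  rw [← sumElim_sub, sub_self, Subsingleton.elim (default - default) default]
  exact h

/-- In modules over the same parameters, tuples with the same code have the same type: by the
Baur–Monk theorem it suffices to consider formulas defining subgroups, and two instances of such a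
formula define the same coset or disjoint ones, which the theory of the parameters decides. -/
theorem realize_iff_of_code_eq {A : Type u'} {n : ℕ} {N N' : Type v}
    [(moduleLanguage R).Structure N] [(moduleLanguage R).Structure N']
    (hN : IsModuleStructure R N) (hN' : IsModuleStructure R N') {c : A → N} {c' : A → N'}
    (hc : ∀ χ : (moduleLanguage R).Formula A, χ.Realize c ↔ χ.Realize c')
    {v : Fin n → N} {v' : Fin n → N'} (h : code (L := moduleLanguage R) c v = code c' v')
    (φ : (moduleLanguage R).Formula (A ⊕ Fin n)) :
    φ.Realize (Sum.elim c v) ↔ φ.Realize (Sum.elim c' v') := by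
  have hNN' : N ≅[moduleLanguage R] N' := by
    refine elementarilyEquivalent_iff.2 fun σ => ?_
    have := hc (σ.relabel Empty.elim)
    rw [Formula.realize_relabel, Formula.realize_relabel,
      Subsingleton.elim (c ∘ Empty.elim) default, Subsingleton.elim (c' ∘ Empty.elim) default]
      at this
    exact this
  obtain ⟨m, ψ, a, hψ⟩ := exists_realize_iff_relabel φ
  rw [hψ, hψ]
  obtain ⟨ι, _, f, hf, hdet⟩ := exists_definesSubgroup_determining.{u, v} ψ
  have key : ∀ {N N' : Type v} [(moduleLanguage R).Structure N] [(moduleLanguage R).Structure N']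
      (hN' : IsModuleStructure R N') {c : A → N} {c' : A → N'}
      (hc : ∀ χ : (moduleLanguage R).Formula A, χ.Realize c ↔ χ.Realize c')
      {v : Fin n → N} {v' : Fin n → N'} (h : code (L := moduleLanguage R) c v = code c' v') (i : ι),
      Formula.Realize (f i) (Sum.elim (c ∘ a) v) →
        Formula.Realize (f i) (Sum.elim (c' ∘ a) v') := by
    intro N N' _ _ hN' c c' hc v v' h i ha
    obtain ⟨b, hb, hb'⟩ := exists_common_of_code_eq h (f i) ha
    -- That the instances of `f i` at `a` and at `b` have a common solution is a property `χ` of the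
    -- parameters.
    let χ : (moduleLanguage R).Formula A :=
      Formula.iExs (Fin n) (Formula.relabel (Sum.map a id) (f i) ⊓
        Formula.relabel (Sum.map b id) (f i))
    have hχ := hc χ
    simp only [χ, Formula.realize_iExs, Formula.realize_inf, Formula.realize_relabel,
      Sum.elim_comp_map, Function.comp_id] at hχ
    obtain ⟨x, hax, hbx⟩ := hχ.1 ⟨v, ha, hb⟩
    exact (hf i).realize_exchange hN' hax hbx hb'
  have key' : ∀ i, Formula.Realize (f i) (Sum.elim (c ∘ a) v) ↔
      Formula.Realize (f i) (Sum.elim (c' ∘ a) v') := fun i =>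
    ⟨key hN' hc h i, key hN (fun χ => (hc χ).symm) h.symm i⟩
  obtain ⟨_, _, rfl⟩ := hN
  obtain ⟨_, _, rfl⟩ := hN'
  exact hdet N N' hNN' _ _ _ _ key'

end Codes

/-! ### Elementary amalgamation -/

section Amalgamation

open Language

universe x x'

/-- The compactness theorem for a set of formulas in possibly infinitely many variables. -/
theorem exists_realize_of_finitely_realized {L : FirstOrder.Language.{u, 0}}
    {γ : Type (max u w)} (Γ : Set (L.Formula γ)) {M : Type x} [L.Structure M] [Nonempty M]
    (h : ∀ S : Finset (L.Formula γ), (S : Set (L.Formula γ)) ⊆ Γ →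
      ∃ v : γ → M, ∀ φ ∈ S, φ.Realize v) :
    ∃ (P : Type (max u w)) (_ : L.Structure P) (v : γ → P), ∀ φ ∈ Γ, φ.Realize v := by
  classical
  have hsat : Theory.IsSatisfiable ((Formula.equivSentence '' Γ : Set _) : L[[γ]].Theory) := by
    rw [Theory.isSatisfiable_iff_isFinitelySatisfiable]
    intro T₀ hT₀
    obtain ⟨S, hS, rfl⟩ := Finset.subset_set_image_iff.1 hT₀
    obtain ⟨v, hv⟩ := h S hS
    let : (constantsOn γ).Structure M := constantsOn.structure v
    have : M ⊨ ((S.image Formula.equivSentence : Finset _) : L[[γ]].Theory) := by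
      rw [Theory.model_iff]
      intro σ hσ
      obtain ⟨φ, hφ, rfl⟩ := Finset.mem_image.1 (Finset.mem_coe.1 hσ)
      rw [Formula.realize_equivSentence]
      exact hv φ hφ
    exact Theory.Model.isSatisfiable M
  obtain ⟨P⟩ := hsat
  let : L.Structure P := (L.lhomWithConstants γ).reduct P
  have : (L.lhomWithConstants γ).IsExpansionOn P := LHom.isExpansionOn_reduct _ P
  refine ⟨P, inferInstance, fun a => (L.con a : P), fun φ hφ => ?_⟩
  rw [← Formula.realize_equivSentence]
  exact P.is_model.realize_of_mem _ ⟨φ, hφ, rfl⟩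

/-- The projection of a definable set is definable even if infinitely many variables are
projected out, since only finitely many occur. -/
theorem exists_formula_iff_exists_realize {L : FirstOrder.Language} {B : Type x} {γ : Type x'}
    (φ : L.Formula (B ⊕ γ)) :
    ∃ ψ : L.Formula B, ∀ (M : Type w) [L.Structure M] [Nonempty M] (v : B → M),
      ψ.Realize v ↔ ∃ u : γ → M, φ.Realize (Sum.elim v u) := by
  classical
  let s : Finset γ := φ.freeVarFinset.toRight
  let f : φ.freeVarFinset → B ⊕ s := fun x => match x with
    | ⟨Sum.inl b, _⟩ => Sum.inl b
    | ⟨Sum.inr c, h⟩ => Sum.inr ⟨c, Finset.mem_toRight.2 h⟩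
  have hf : ∀ (M : Type w) [L.Structure M] (v : B → M) (u : γ → M),
      Formula.Realize (φ.restrictFreeVar f) (Sum.elim v fun i : s => u i) ↔
        φ.Realize (Sum.elim v u) := by
    intro M _ v u
    refine BoundedFormula.realize_restrictFreeVar (Sum.elim v u) ?_
    rintro ⟨b | c, h⟩ <;> simp [f]
  refine ⟨Formula.iExs s (φ.restrictFreeVar f), fun M _ _ v => ?_⟩
  rw [Formula.realize_iExs]
  constructor
  · rintro ⟨u, hu⟩
    refine ⟨fun c => if h : c ∈ s then u ⟨c, h⟩ else Classical.arbitrary M, ?_⟩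
    rw [← hf]
    simpa using hu
  · rintro ⟨u, hu⟩
    exact ⟨fun i => u i, (hf M v u).2 hu⟩

/-- Elementary amalgamation: two structures in which the parameters `v₁` and `v₂` satisfy the same
formulas have a common elementary extension in which these parameters are identified. -/
theorem exists_elementary_amalgam {L : FirstOrder.Language.{u, 0}} {B : Type x}
    {N₁ N₂ : Type (max u w)} [L.Structure N₁] [L.Structure N₂] [Nonempty N₁] [Nonempty N₂]
    {v₁ : B → N₁} {v₂ : B → N₂} (h : ∀ φ : L.Formula B, φ.Realize v₁ ↔ φ.Realize v₂) :
    ∃ (P : Type (max u w)) (_ : L.Structure P) (f : N₁ ↪ₑ[L] P) (g : N₂ ↪ₑ[L] P),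
      ∀ b, f (v₁ b) = g (v₂ b) := by
  classical
  -- The elementary diagrams of `N₁` and `N₂` and the equations that identify the parameters. Finitely
  -- many of these formulas can be realized in `N₁`.
  let Γ₁ : Set (L.Formula (N₁ ⊕ N₂)) :=
    {χ | ∃ φ : L.Formula N₁, φ.Realize id ∧ φ.relabel Sum.inl = χ}
  let Γ₂ : Set (L.Formula (N₁ ⊕ N₂)) :=
    {χ | ∃ φ : L.Formula N₂, φ.Realize id ∧ φ.relabel Sum.inr = χ}
  let Γ₃ : Set (L.Formula (N₁ ⊕ N₂)) :=
    {χ | ∃ b : B, (Term.var (Sum.inl (v₁ b))).equal (Term.var (Sum.inr (v₂ b))) = χ}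
  have hfin : ∀ S : Finset (L.Formula (N₁ ⊕ N₂)), (S : Set _) ⊆ Γ₁ ∪ Γ₂ ∪ Γ₃ →
      ∃ v : N₁ ⊕ N₂ → N₁, ∀ φ ∈ S, φ.Realize v := by
    intro S hS
    -- What `S` says about `N₂` and the parameters, with the parameters as variables.
    let tr : L.Formula (N₁ ⊕ N₂) → L.Formula (B ⊕ N₂) := fun χ =>
      if h₂ : χ ∈ Γ₂ then h₂.choose.relabel Sum.inr
      else if h₃ : χ ∈ Γ₃ then
        (Term.var (Sum.inl h₃.choose)).equal (Term.var (Sum.inr (v₂ h₃.choose)))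
      else ⊤
    obtain ⟨ψ, hψ⟩ := exists_formula_iff_exists_realize.{max u w} (Formula.iInf fun χ : S => tr χ)
    have h₂ : ψ.Realize v₂ := by
      rw [hψ]
      refine ⟨id, ?_⟩
      rw [Formula.realize_iInf]
      intro χ
      simp only [tr]
      split_ifs with h₂ h₃
      · rw [Formula.realize_relabel, Sum.elim_comp_inr]
        exact h₂.choose_spec.1
      · simp
      · exact BoundedFormula.realize_top.2 trivial
    obtain ⟨u, hu⟩ := (hψ N₁ v₁).1 ((h ψ).2 h₂)
    rw [Formula.realize_iInf] at hu
    refine ⟨Sum.elim id u, fun χ hχ => ?_⟩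
    have huχ := hu ⟨χ, hχ⟩
    simp only [tr] at huχ
    split_ifs at huχ with h₂ h₃
    · rw [Formula.realize_relabel, Sum.elim_comp_inr] at huχ
      rw [← h₂.choose_spec.2, Formula.realize_relabel, Sum.elim_comp_inr]
      exact huχ
    · rw [← h₃.choose_spec]
      simpa using huχ
    · obtain ⟨φ, hφ, rfl⟩ := ((hS hχ).resolve_right h₃).resolve_right h₂
      rw [Formula.realize_relabel, Sum.elim_comp_inl]
      exact hφ
  obtain ⟨P, _, v, hv⟩ := exists_realize_of_finitely_realized.{u, w} (Γ₁ ∪ Γ₂ ∪ Γ₃) hfin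
  have iff_of_imp : ∀ {N : Type (max u w)} [L.Structure N] (j : N → P),
      (∀ φ : L.Formula N, φ.Realize id → φ.Realize j) →
      ∀ {n : ℕ} (φ : L.Formula (Fin n)) (y : Fin n → N), φ.Realize (j ∘ y) ↔ φ.Realize y := by
    intro N _ j hj n φ y
    have h1 := hj (φ.relabel y)
    have h2 := hj (∼(φ.relabel y))
    simp only [Formula.realize_not, Formula.realize_relabel, Function.id_comp] at h1 h2
    exact ⟨not_imp_not.1 h2, h1⟩
  refine ⟨P, inferInstance, ⟨v ∘ Sum.inl, fun n => iff_of_imp _ fun φ hφ => ?_⟩,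
    ⟨v ∘ Sum.inr, fun n => iff_of_imp _ fun φ hφ => ?_⟩, fun b => ?_⟩
  · exact Formula.realize_relabel.1 (hv _ (Or.inl (Or.inl ⟨φ, hφ, rfl⟩)))
  · exact Formula.realize_relabel.1 (hv _ (Or.inl (Or.inr ⟨φ, hφ, rfl⟩)))
  · have hb := hv _ (Or.inr ⟨b, rfl⟩)
    rwa [Formula.realize_equal] at hb

end Amalgamation

/-! ### Counting types -/

section Counting

open Language

variable {R : Type u} [Ring R] {T : (moduleLanguage R).Theory}

/-- The reduct to the language of `R`-modules of a structure with the same theory with parameters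
as a model of `T` is a module. -/
theorem isModuleStructure_reduct (hR : IsTheoryOfModules.{u, w} R T)
    (M : T.ModelType.{u, 0, max u w}) (A : Set M)
    (N : ((moduleLanguage R)[[A]].completeTheory M).ModelType.{max u w, 0, max u w}) :
    @IsModuleStructure R _ N (((moduleLanguage R).lhomWithConstants A).reduct N) := by
  have hsub : ((moduleLanguage R).lhomWithConstants A).onTheory T ⊆
      (moduleLanguage R)[[A]].completeTheory M :=
    Theory.model_iff_subset_completeTheory.1 ((LHom.onTheory_model _ T).2 M.is_model)
  exact hR ((N.subtheoryModel hsub).reduct ((moduleLanguage R).lhomWithConstants A))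

theorem mk_completeType_le (hR : IsTheoryOfModules.{u, w} R T)
    (M : T.ModelType.{u, 0, max u w}) (A : Set M) (n : ℕ) :
    #(((moduleLanguage R)[[A]].completeTheory M).CompleteType (Fin n)) ≤
      #(Code (moduleLanguage R) A n) := by
  have hreal : ∀ p : ((moduleLanguage R)[[A]].completeTheory M).CompleteType (Fin n),
      ∃ (N : ((moduleLanguage R)[[A]].completeTheory M).ModelType.{max u w, 0, max u w})
        (v : Fin n → N), ((moduleLanguage R)[[A]].completeTheory M).typeOf v = p := fun p =>
    Theory.exists_modelType_is_realized_in _ p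
  choose N v hv using hreal
  let S : ∀ p, (moduleLanguage R).Structure (N p) := fun p =>
    ((moduleLanguage R).lhomWithConstants A).reduct (N p)
  have hS : ∀ p, ((moduleLanguage R).lhomWithConstants A).IsExpansionOn (N p) := fun p =>
    LHom.isExpansionOn_reduct _ _
  let c : ∀ p, A → N p := fun p a => ((moduleLanguage R).con a : N p)
  have hmem : ∀ p φ, φ ∈ p ↔ Formula.Realize
      (BoundedFormula.constantsVarsEquiv (Formula.equivSentence.symm φ))
      (Sum.elim (c p) (v p)) := by
    intro p φ
    conv_lhs => rw [← hv p]
    rw [Theory.CompleteType.mem_typeOf]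
    exact BoundedFormula.realize_constantsVarsEquiv.symm
  have hbase : ∀ p (χ : (moduleLanguage R).Formula A), χ.Realize (c p) ↔
      χ.Realize fun a : A =>
        (((moduleLanguage R).con a : (moduleLanguage R)[[A]].Constants) : M) := by
    intro p χ
    rw [← Formula.realize_equivSentence, ← Formula.realize_equivSentence]
    exact realize_iff_of_model_completeTheory M (N p) _
  refine mk_le_of_injective (f := fun p => code (c p) (v p)) fun p q hpq => ?_
  refine SetLike.ext fun φ => ?_
  rw [hmem, hmem]
  exact realize_iff_of_code_eq (isModuleStructure_reduct hR M A (N p))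
    (isModuleStructure_reduct hR M A (N q))
    (fun χ => (hbase p χ).trans (hbase q χ).symm) hpq _

/-- Extensions of `M` by an element with the same code over `M` have the same orbital type, as
elements of the same type can be identified in an elementary amalgam. -/
theorem atomicEquiv_of_code_eq (hR : IsTheoryOfModules.{u, w} R T)
    {M : T.ModelType.{u, 0, max u w}} {p q : PointedExtension.{u, w} M}
    (h : code (L := moduleLanguage R) p.incl (fun _ : Fin 1 => p.b) =
      code q.incl fun _ : Fin 1 => q.b) :
    AtomicEquiv p q := by
  have htype := realize_iff_of_code_eq (hR p.N) (hR q.N) (c := p.incl) (c' := q.incl)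
    (fun χ => by
      have h1 := p.incl.map_formula χ id
      have h2 := q.incl.map_formula χ id
      exact h1.trans h2.symm) h
  obtain ⟨P, _, f, g, hfg⟩ := exists_elementary_amalgam.{u, w} htype
  have : Nonempty P := p.N.nonempty'.map f
  have : P ⊨ T := (f.theory_model_iff T).1 p.N.is_model
  exact ⟨Theory.ModelType.of T P, f, g, fun m => hfg (Sum.inl m), hfg (Sum.inr 0)⟩

theorem mk_orbitalType_le (hR : IsTheoryOfModules.{u, w} R T)
    (M : T.ModelType.{u, 0, max u w}) :
    #(OrbitalType.{u, w} M) ≤ lift.{max (u + 1) (w + 1)} #(Code (moduleLanguage R) M 1) := by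
  let F : OrbitalType.{u, w} M → Code (moduleLanguage R) M 1 := fun t =>
    code (Quot.out t).incl fun _ => (Quot.out t).b
  have hF : Function.Injective F := by
    intro s t hst
    rw [← Quot.out_eq s, ← Quot.out_eq t]
    exact Quot.sound (atomicEquiv_of_code_eq hR hst)
  have := mk_le_of_injective (f := fun t => ULift.up.{max (u + 1) (w + 1)} (F t))
    (ULift.up_injective.comp hF)
  simpa using this

end Counting

/-- There are arbitrarily large cardinals `μ` with `μ ^ ν = μ`, namely the powers `κ ^ ν` of infinite `κ`. -/
theorem exists_le_power_eq_self (κ ν : Cardinal.{u}) (hν : ℵ₀ ≤ ν) :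
    ∃ μ, κ ≤ μ ∧ ℵ₀ ≤ μ ∧ μ ^ ν = μ := by
  have h : max ℵ₀ κ ≤ max ℵ₀ κ ^ ν := self_le_power _ (one_le_aleph0.trans hν)
  refine ⟨max ℵ₀ κ ^ ν, (le_max_right _ _).trans h, (le_max_left _ _).trans h, ?_⟩
  rw [← power_mul, mul_eq_self hν]

end ModuleStability

theorem corollary1p5 (R : Type u) [Ring R] (T : (ModuleStability.moduleLanguage R).Theory)
    (hT : T.IsComplete) (hR : ModuleStability.IsTheoryOfModules.{u, w} R T) :
    ModuleStability.FirstOrderStable.{u, w} T ∧ ModuleStability.OrbitallyStable.{u, w} T := by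
  have hν : ℵ₀ ≤ lift.{w} (max ℵ₀ (ModuleStability.moduleLanguage R).card) :=
    aleph0_le_lift.2 (le_max_left _ _)
  constructor
  · intro κ
    obtain ⟨μ, hκ, hμ, hpow⟩ := ModuleStability.exists_le_power_eq_self κ _ hν
    exact ⟨μ, hκ, fun M A hA n => (ModuleStability.mk_completeType_le hR M A n).trans
      (ModuleStability.mk_code_le hμ hpow hA)⟩
  · intro κ
    obtain ⟨μ, hκ, hμ, hpow⟩ := ModuleStability.exists_le_power_eq_self κ _ hν
    exact ⟨μ, hκ, fun M hM => (ModuleStability.mk_orbitalType_le hR M).trans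
      (lift_le.2 (ModuleStability.mk_code_le hμ hpow hM.le))⟩
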